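/- Let $\Phi$ and $\Psi$ be independent homogeneous Poisson point processes in $\mathbb R^2$ of intensities $1$ (nodes) and $\lambda\ge 0$ (eavesdroppers), and let $0<r\le\infty$, with $r<\infty$ if $\lambda=0$. For a node set $\varphi\subset\mathbb R^2$, call $\overrightarrow{xy}$ ($x\ne y$ in $\varphi$) secure if $\|x-y\|\le r$ and the closed disk centred at $x$ with radius $\|x-y\|$ contains no point of $\Psi$. The basic secrecy graph on $\varphi$ has the edges $xy$ for which $\overrightarrow{xy}$ and $\overrightarrow{yx}$ are both secure; the enhanced secrecy graph has the edges $xy$ for which at least one of them is secure. Let $G_{\lambda,r}$ and $G'_{\lambda,r}$ be the basic and the enhanced graph on $\varphi=\Phi$, and let $N$ and $N'$ be the degrees of the origin $o$ in the basic and the enhanced graph on $\varphi=\Phi\cup\{o\}$. Put $c=\frac43+\frac{\sqrt3}{2\pi}$. (i) In terms of edge densities, at least a fraction $\frac{3\pi}{5\pi+3\sqrt3}\approx0.45$ of the edges of $G'_{\lambda,r}$ are edges of $G_{\lambda,r}$: for every Borel set $B\subset\mathbb R^2$ with $0<|B|<\infty$, the expected number of edges of $G'_{\lambda,r}$ with midpoint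 in $B$ is positive and finite, and the expected number of edges of $G_{\lambda,r}$ with midpoint in $B$ is at least $\frac{3\pi}{5\pi+3\sqrt3}$ times it. Moreover $\left|\frac{3\pi}{5\pi+3\sqrt3}-0.45\right|<0.005$. (ii) $0<\mathbb E N'<\infty$, and $\mathbb E N/\mathbb E N'=\rho(\lambda r^2)$ for a strictly decreasing function $\rho:[0,\infty]\to\mathbb R$ with $\rho(0)=1$, $\rho(t)\to1$ as $t\to0$, and $\rho(t)\to\rho(\infty)=(2c-1)^{-1}$ as $t\to\infty$. In particular, $(2c-1)^{-1}$ is the minimum of the ratio, reached exactly for $\lambda r^2=\infty$, that is, for $r=\infty$. -/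

import Mathlib

open MeasureTheory ProbabilityTheory Filter Topology
open scoped NNReal ENNReal

namespace SecrecyGraph

/-- The Euclidean plane. -/
abbrev Plane : Type := EuclideanSpace ℝ (Fin 2)

/-! ### Graphs

All graphs are on the whole plane, and only points of the node set `φ` carry edges. -/

/-- Gilbert's disk graph on the node set `φ`: two distinct nodes are joined when their distance is
at most `r`; for `r = ∞` this is the complete graph on `φ`. -/
def diskGraph (φ : Set Plane) (r : ℝ≥0∞) : SimpleGraph Plane where
  Adj x y := x ≠ y ∧ x ∈ φ ∧ y ∈ φ ∧ edist x y ≤ r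
  symm := ⟨fun x y h => ⟨h.1.symm, h.2.2.1, h.2.1, by rw [edist_comm]; exact h.2.2.2⟩⟩
  loopless := ⟨fun _ h => h.1 rfl⟩

/-- The directed secrecy graph of the graph `H` in the presence of the eavesdroppers `ψ`: the
directed edge from `x` to `y` is kept when no eavesdropper lies in the closed ball
centred at `x` with radius the distance from `x` to `y`. -/
def directedGraph (H : SimpleGraph Plane) (ψ : Set Plane) : Digraph Plane where
  Adj x y := H.Adj x y ∧ ψ ∩ Metric.closedBall x (dist x y) = ∅

/-- The basic secrecy graph: both directions of the edge are present in the directed graph. -/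
def basicGraph (H : SimpleGraph Plane) (ψ : Set Plane) : SimpleGraph Plane where
  Adj x y := (directedGraph H ψ).Adj x y ∧ (directedGraph H ψ).Adj y x
  symm := ⟨fun _ _ h => ⟨h.2, h.1⟩⟩
  loopless := ⟨fun x h => H.loopless.irrefl x h.1.1⟩

/-- The enhanced secrecy graph: at least one direction of the edge is present in the directed
graph. -/
def enhancedGraph (H : SimpleGraph Plane) (ψ : Set Plane) : SimpleGraph Plane where
  Adj x y := (directedGraph H ψ).Adj x y ∨ (directedGraph H ψ).Adj y x
  symm := ⟨fun _ _ h => h.symm⟩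
  loopless := ⟨fun x h => h.elim (fun h => H.loopless.irrefl x h.1)
    (fun h => H.loopless.irrefl x h.1)⟩

/-- The number of neighbours of `x` in `G`, possibly infinite. -/
noncomputable def degree (G : SimpleGraph Plane) (x : Plane) : ℕ∞ :=
  (G.neighborSet x).encard

/-- The number of (undirected) edges of `G` located in `B`, where the location of an edge is its
midpoint. -/
noncomputable def edgeCount (G : SimpleGraph Plane) (B : Set Plane) : ℕ∞ :=
  {e : Sym2 Plane | ∃ x y, e = s(x, y) ∧ G.Adj x y ∧ midpoint ℝ x y ∈ B}.encard

/-! ### Poisson point processes -/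

section Poisson

variable {Ω : Type*}

/-- The number of points of the random set `Φ` in `B`. -/
noncomputable def count (Φ : Ω → Set Plane) (B : Set Plane) (ω : Ω) : ℕ∞ :=
  (Φ ω ∩ B).encard

/-- The random set `Φ` is a homogeneous Poisson point process in the plane with intensity `μ`:
it is locally finite, the numbers of points in Borel sets are random variables, the number of
points in a Borel set of finite area `a` is Poisson distributed with mean `μ a`, and the numbers of
points in pairwise disjoint Borel sets are independent. -/
structure IsPoissonProcess [MeasurableSpace Ω] (Φ : Ω → Set Plane) (μ : ℝ≥0) (P : Measure Ω) :
    Prop where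
  finite_inter : ∀ ω, ∀ B : Set Plane, Bornology.IsBounded B → (Φ ω ∩ B).Finite
  measurable_count : ∀ B : Set Plane, MeasurableSet B → Measurable (count Φ B)
  map_count : ∀ B : Set Plane, MeasurableSet B → volume B ≠ ∞ →
    P.map (count Φ B) =
      (poissonMeasure (μ * (volume B).toNNReal)).map (fun n : ℕ => (n : ℕ∞))
  indep_count : ∀ (n : ℕ) (B : Fin n → Set Plane), (∀ i, MeasurableSet (B i)) →
    Pairwise (fun i j => Disjoint (B i) (B j)) → iIndepFun (fun i => count Φ (B i)) P

/-- The σ-algebra on `Ω` generated by the random set `Φ`, i.e. by its numbers of points in all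
Borel sets. -/
noncomputable abbrev generatedSigma (Φ : Ω → Set Plane) : MeasurableSpace Ω :=
  ⨆ B : {B : Set Plane // MeasurableSet B},
    MeasurableSpace.comap (count Φ B.1) inferInstance

/-- Nodes `Φ` and eavesdroppers `Ψ` of the Poisson model: independent Poisson processes of
intensities `1` and `lam`. -/
structure IsPoissonModel [MeasurableSpace Ω] (Φ Ψ : Ω → Set Plane) (lam : ℝ≥0) (P : Measure Ω) :
    Prop where
  nodes : IsPoissonProcess Φ 1 P
  eavesdroppers : IsPoissonProcess Ψ lam P
  indep : Indep (generatedSigma Φ) (generatedSigma Ψ) P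

/-- The mean degree of the origin in the basic secrecy graph, where a node is placed
at the origin. -/
noncomputable def meanDegreeBasic [MeasurableSpace Ω] (Φ Ψ : Ω → Set Plane) (r : ℝ≥0∞)
    (P : Measure Ω) : ℝ≥0∞ :=
  ∫⁻ ω, (degree (basicGraph (diskGraph (insert 0 (Φ ω)) r) (Ψ ω)) 0 : ℝ≥0∞) ∂P

/-- The mean degree of the origin in the enhanced secrecy graph, where a node is placed
at the origin. -/
noncomputable def meanDegreeEnhanced [MeasurableSpace Ω] (Φ Ψ : Ω → Set Plane) (r : ℝ≥0∞)
    (P : Measure Ω) : ℝ≥0∞ :=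
  ∫⁻ ω, (degree (enhancedGraph (diskGraph (insert 0 (Φ ω)) r) (Ψ ω)) 0 : ℝ≥0∞) ∂P

/-- The expected number of edges of the basic secrecy graph located in `B`. -/
noncomputable def meanEdgesBasic [MeasurableSpace Ω] (Φ Ψ : Ω → Set Plane) (r : ℝ≥0∞)
    (P : Measure Ω) (B : Set Plane) : ℝ≥0∞ :=
  ∫⁻ ω, (edgeCount (basicGraph (diskGraph (Φ ω) r) (Ψ ω)) B : ℝ≥0∞) ∂P

/-- The expected number of edges of the enhanced secrecy graph located in `B`. -/
noncomputable def meanEdgesEnhanced [MeasurableSpace Ω] (Φ Ψ : Ω → Set Plane) (r : ℝ≥0∞)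
    (P : Measure Ω) (B : Set Plane) : ℝ≥0∞ :=
  ∫⁻ ω, (edgeCount (enhancedGraph (diskGraph (Φ ω) r) (Ψ ω)) B : ℝ≥0∞) ∂P

end Poisson

/-- The constant `c`: the area of the union of two disks of radius `R` whose centres are at
distance `R` is `c π R ^ 2`. -/
noncomputable def c : ℝ := 4 / 3 + √3 / (2 * Real.pi)

end SecrecyGraph

namespace SecrecyGraph

/-! ### Locally finite configurations -/

/-! Fix two nodes at distance `d`. One direction of the pair is secure when a disk of area `π d²`
contains no eavesdropper, which has probability `exp (-λπd²)`. Both directions are secure when the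
union of the two disks is empty; its area is `c π d²`, so the probability is `exp (-λcπd²)`
(`volume_closedBall_union_closedBall`). By inclusion-exclusion, P(either) + P(both) = 2 P(one).

Campbell's formula integrates these probabilities over the disk of radius `r`: `E N = ∫ exp
(-λcπ‖x‖²)` and `E N + E N' = 2 ∫ exp (-λπ‖x‖²)`. Substituting `t = π‖x‖²` and writing `u = exp
(-πλr²)`, the integrals become `(1 - u^c)/(λc)` and `(1 - u)/λ`. Their quotient `k(u) = (1 -
u^c)/(c(1 - u))` is a normalized secant slope of the convex function `u^c`, so it increases from
`1/c` at `u = 0` to `1` at `u = 1`. Hence `E N / E N' = k/(2 - k)`, which is strictly decreasing in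
`λr²` with limits `1` and `1/(2c - 1)` (`gaussDisk_div`, `degreeRatio_strictAnti`).

For edge densities, the second moment measure of the nodes is Lebesgue × Lebesgue off the diagonal.
Integrating over pairs with midpoint in `B` gives `|B|` times the same disk integrals
(`two_mul_lintegral_edgeCount`). The factor `|B|` cancels, and the lower bound is the value of the
ratio at `λr² = ∞`. -/

/-- Locally finite subsets of the plane. -/
def Config : Type := {φ : Set Plane // ∀ B : Set Plane, Bornology.IsBounded B → (φ ∩ B).Finite}

namespace Config

/-- The set of points of a configuration. -/
def points (φ : Config) : Set Plane := φ.1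

/-- The σ-algebra generated by the numbers of points in Borel sets. -/
noncomputable instance instMeasurableSpace : MeasurableSpace Config :=
  ⨆ B : {B : Set Plane // MeasurableSet B},
    MeasurableSpace.comap (fun φ : Config => (φ.points ∩ B.1).encard) inferInstance

lemma measurable_encard_inter {B : Set Plane} (hB : MeasurableSet B) :
    Measurable fun φ : Config => (φ.points ∩ B).encard := by
  rw [measurable_iff_comap_le]
  exact le_iSup (fun B : {B : Set Plane // MeasurableSet B} =>
    MeasurableSpace.comap (fun φ : Config => (φ.points ∩ B.1).encard) inferInstance) ⟨B, hB⟩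

lemma countable_points (φ : Config) : φ.points.Countable := by
  have : φ.points = ⋃ n : ℕ, φ.points ∩ Metric.closedBall 0 n := by
    rw [← Set.inter_iUnion, Metric.iUnion_closedBall_nat, Set.inter_univ]
  rw [this]
  exact Set.countable_iUnion fun n => (φ.2 _ Metric.isBounded_closedBall).countable

instance (φ : Config) : Countable φ.points := φ.countable_points.to_subtype

end Config

lemma sum_dirac_apply {X : Type*} [MeasurableSpace X] (s : Set X) {B : Set X}
    (hB : MeasurableSet B) :
    Measure.sum (fun x : s => Measure.dirac (x : X)) B = ((s ∩ B).encard : ℝ≥0∞) := by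
  classical
  rw [Measure.sum_apply _ hB]
  simp only [Measure.dirac_apply' _ hB]
  rw [tsum_subtype s (fun x => B.indicator 1 x), Set.indicator_indicator,
    ← tsum_subtype (s ∩ B) (1 : X → ℝ≥0∞)]
  exact ENNReal.tsum_set_one _

/-- The counting measure of a configuration. -/
noncomputable def pointKernel : Kernel Config Plane where
  toFun φ := Measure.sum fun x : φ.points => Measure.dirac (x : Plane)
  measurable' := by
    refine Measure.measurable_of_measurable_coe _ fun B hB => ?_
    simp only [sum_dirac_apply _ hB]
    exact Measurable.of_discrete.comp (Config.measurable_encard_inter hB)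

lemma pointKernel_apply (φ : Config) :
    pointKernel φ = Measure.sum fun x : φ.points => Measure.dirac (x : Plane) := rfl

lemma pointKernel_apply_set (φ : Config) {B : Set Plane} (hB : MeasurableSet B) :
    pointKernel φ B = ((φ.points ∩ B).encard : ℝ≥0∞) :=
  sum_dirac_apply _ hB

/-- The total mass may be infinite, so the plane is cut into bounded rings `A n` and, for each ring,
the configurations are sorted by their number `k` of points there. The piece indexed by `(n, k)` has
mass at most `k`. -/
instance : IsSFiniteKernel pointKernel := by
  classical
  let A : ℕ → Set Plane := disjointed fun n : ℕ => Metric.closedBall (0 : Plane) n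
  have hA : ∀ n, MeasurableSet (A n) := fun n =>
    MeasurableSet.disjointed (fun _ => Metric.isClosed_closedBall.measurableSet) n
  have hAb : ∀ n, Bornology.IsBounded (A n) := fun n =>
    Metric.isBounded_closedBall.subset (disjointed_subset _ n)
  have hAd : Pairwise (Function.onFun Disjoint A) := disjoint_disjointed _
  have hAu : ⋃ n, A n = Set.univ := by
    rw [iUnion_disjointed, Metric.iUnion_closedBall_nat]
  have hS : ∀ p : ℕ × ℕ,
      MeasurableSet {φ : Config | (φ.points ∩ A p.1).encard = (p.2 : ℕ∞)} := fun p =>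
    Config.measurable_encard_inter (hA p.1) (measurableSet_singleton _)
  let κ : ℕ × ℕ → Kernel Config Plane := fun p =>
    Kernel.piecewise (hS p) (pointKernel.restrict (hA p.1)) 0
  have hκ : ∀ p, IsFiniteKernel (κ p) := by
    intro p
    refine ⟨⟨p.2, ENNReal.natCast_lt_top _, fun φ => ?_⟩⟩
    simp only [κ, Kernel.piecewise_apply]
    split_ifs with h
    · rw [Kernel.restrict_apply, Measure.restrict_apply_univ, pointKernel_apply_set _ (hA _)]
      simp only [Set.mem_ofPred_eq] at h
      rw [h]; simp
    · simp
  have hsum : pointKernel = Kernel.sum κ := by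
    ext φ B hB
    rw [Kernel.sum_apply' _ _ hB, ENNReal.tsum_prod']
    have h1 : ∀ n, ∑' k, κ (n, k) φ B = pointKernel φ (B ∩ A n) := by
      intro n
      obtain ⟨k, hk⟩ := ENat.ne_top_iff_exists.1
        (Set.encard_ne_top_iff.2 (φ.2 _ (hAb n)))
      rw [tsum_eq_single k]
      · simp only [κ, Kernel.piecewise_apply]
        rw [if_pos (show φ ∈ {φ : Config | (φ.points ∩ A n).encard = (k : ℕ∞)} from hk.symm),
          Kernel.restrict_apply, Measure.restrict_apply hB]
      · intro j hj
        simp only [κ, Kernel.piecewise_apply]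
        rw [if_neg]
        · simp
        · intro h
          apply hj
          have h' : (k : ℕ∞) = (j : ℕ∞) := hk.trans h
          exact_mod_cast h'.symm
    simp only [h1]
    rw [← measure_iUnion (fun i j hij => (hAd hij).mono Set.inter_subset_right
      Set.inter_subset_right) (fun n => hB.inter (hA n)), ← Set.inter_iUnion, hAu, Set.inter_univ]
  rw [hsum]
  infer_instance

/-- The counting measure of the ordered pairs of points of a configuration. -/
noncomputable def pairKernel : Kernel Config (Plane × Plane) := pointKernel ×ₖ pointKernel

instance : IsSFiniteKernel pairKernel := by unfold pairKernel; infer_instance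

lemma pairKernel_apply_set (φ : Config) {S : Set (Plane × Plane)} (hS : MeasurableSet S) :
    pairKernel φ S = ((φ.points ×ˢ φ.points ∩ S).encard : ℝ≥0∞) := by
  rw [pairKernel, Kernel.prod_apply, pointKernel_apply, Measure.prod_sum]
  simp only [Measure.dirac_prod_dirac]
  rw [← sum_dirac_apply _ hS]
  rw [Measure.sum_apply _ hS, Measure.sum_apply _ hS]
  exact (Equiv.Set.prod φ.points φ.points).symm.tsum_eq
    (fun p : (φ.points ×ˢ φ.points : Set _) => Measure.dirac (p : Plane × Plane) S)

lemma pairKernel_apply_prod (φ : Config) (A B : Set Plane) :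
    pairKernel φ (A ×ˢ B) = pointKernel φ A * pointKernel φ B := by
  rw [pairKernel, Kernel.prod_apply, Measure.prod_prod]

/-! ### Measurability of secrecy -/

/-- The pairs `x`, `y` and configurations `ψ` without points in the closed ball centred at `x`
with radius `dist x y`. -/
def securePairs : Set ((Plane × Plane) × Config) :=
  {q | q.2.points ∩ Metric.closedBall q.1.1 (dist q.1.1 q.1.2) = ∅}

/-- Emptiness of the disk means that the counting kernel vanishes on a section of a measurable set,
and the mass of sections is a measurable function for an s-finite kernel. -/
lemma measurableSet_securePairs : MeasurableSet securePairs := by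
  let κ : Kernel ((Plane × Plane) × Config) Plane :=
    pointKernel.comap Prod.snd measurable_snd
  have hT : MeasurableSet {q : ((Plane × Plane) × Config) × Plane |
      dist q.2 q.1.1.1 ≤ dist q.1.1.1 q.1.1.2} :=
    measurableSet_le (by fun_prop) (by fun_prop)
  have h := Kernel.measurable_kernel_prodMk_left (κ := κ) hT
  convert! h (measurableSet_singleton (0 : ℝ≥0∞)) using 1
  ext q
  simp only [securePairs, Set.mem_ofPred_eq, Set.mem_preimage, Set.mem_singleton_iff, κ,
    Kernel.comap_apply]
  rw [pointKernel_apply_set _ (measurable_prodMk_left hT), ENat.toENNReal_eq_zero,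
    Set.encard_eq_zero]
  rfl

/-! ### Moments of Poisson processes -/

/-- Since `n / n! = 1 / (n - 1)!`, shifting the index turns the sum into `r` times the total mass.
-/
lemma lintegral_natCast_poissonMeasure (r : ℝ≥0) :
    ∫⁻ n : ℕ, (n : ℝ≥0∞) ∂poissonMeasure r = r := by
  have h1 : ∑' n : ℕ, ENNReal.ofReal (Real.exp (-r) * r ^ n / n.factorial) = 1 := by
    rw [← ENNReal.ofReal_tsum_of_nonneg (fun n => by positivity)
      (hasSum_one_poissonMeasure r).summable, (hasSum_one_poissonMeasure r).tsum_eq,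
      ENNReal.ofReal_one]
  have h2 : ∀ n : ℕ, ENNReal.ofReal (Real.exp (-r) * r ^ (n + 1) / (n + 1).factorial) *
      ((n + 1 : ℕ) : ℝ≥0∞) = r * ENNReal.ofReal (Real.exp (-r) * r ^ n / n.factorial) := by
    intro n
    rw [← ENNReal.ofReal_natCast, ← ENNReal.ofReal_coe_nnreal,
      ← ENNReal.ofReal_mul (by positivity), ← ENNReal.ofReal_mul (by positivity)]
    congr 1
    rw [Nat.factorial_succ]
    push_cast
    have : (n.factorial : ℝ) ≠ 0 := by positivity
    field_simp
    ring
  rw [poissonMeasure, lintegral_sum_measure]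
  simp only [lintegral_smul_measure, lintegral_dirac, smul_eq_mul]
  rw [tsum_eq_zero_add' ENNReal.summable]
  simp only [h2, ENNReal.tsum_mul_left, h1]
  simp

section

variable {Ω : Type*} [MeasurableSpace Ω] {P : Measure Ω} {Φ Ψ : Ω → Set Plane} {μ : ℝ≥0}

/-- A Poisson process as a random configuration. -/
def IsPoissonProcess.config (h : IsPoissonProcess Φ μ P) (ω : Ω) : Config :=
  ⟨Φ ω, h.finite_inter ω⟩

namespace IsPoissonProcess

/-- Translates independence of the generated σ-algebras into independence of random configurations.
-/
lemma comap_config (h : IsPoissonProcess Φ μ P) :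
    MeasurableSpace.comap h.config inferInstance = generatedSigma Φ := by
  simp only [generatedSigma, Config.instMeasurableSpace, MeasurableSpace.comap_iSup,
    MeasurableSpace.comap_comp]
  rfl

lemma measurable_config (h : IsPoissonProcess Φ μ P) : Measurable h.config := by
  rw [measurable_iff_comap_le, h.comap_config]
  exact iSup_le fun B => (h.measurable_count B.1 B.2).comap_le

/-- The probability that a Poisson process has no point in `B`. -/
lemma measure_inter_eq_empty (h : IsPoissonProcess Φ μ P) {B : Set Plane}
    (hB : MeasurableSet B) (hB' : volume B ≠ ∞) :
    P {ω | Φ ω ∩ B = ∅} = ENNReal.ofReal (Real.exp (-(μ * (volume B).toReal))) := by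
  have h1 : {ω | Φ ω ∩ B = ∅} = count Φ B ⁻¹' {0} := by
    ext ω
    simp [count]
  have h2 : (fun n : ℕ => (n : ℕ∞)) ⁻¹' {0} = {0} := by
    ext n
    simp
  rw [h1, ← Measure.map_apply (h.measurable_count B hB) (measurableSet_singleton _),
    h.map_count B hB hB', Measure.map_apply .of_discrete (measurableSet_singleton _), h2,
    poissonMeasure_singleton]
  simp [ENNReal.coe_toNNReal_eq_toReal]

lemma lintegral_count (h : IsPoissonProcess Φ μ P) {B : Set Plane}
    (hB : MeasurableSet B) (hB' : volume B ≠ ∞) :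
    ∫⁻ ω, (count Φ B ω : ℝ≥0∞) ∂P = μ * volume B := by
  rw [← lintegral_map (f := fun n : ℕ∞ => (n : ℝ≥0∞)) .of_discrete (h.measurable_count B hB),
    h.map_count B hB hB', lintegral_map .of_discrete .of_discrete]
  simp only [ENat.toENNReal_coe]
  rw [lintegral_natCast_poissonMeasure]
  simp [ENNReal.coe_toNNReal hB']

/-- The intensity measure of a Poisson process. -/
lemma bind_pointKernel (h : IsPoissonProcess Φ μ P) :
    (P.map h.config).bind pointKernel = (μ : ℝ≥0∞) • (volume : Measure Plane) := by
  have key : ∀ B : Set Plane, MeasurableSet B → volume B ≠ ∞ →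
      (P.map h.config).bind pointKernel B = μ * volume B := by
    intro B hB hB'
    rw [Measure.bind_apply hB pointKernel.aemeasurable,
      lintegral_map (pointKernel.measurable_coe hB) h.measurable_config, ← h.lintegral_count hB hB']
    exact lintegral_congr fun ω => pointKernel_apply_set _ hB
  -- The law of the counts is given only for sets of finite area; exhausting the plane by such sets
  -- gives equality of the measures.
  have := Measure.restrict_iUnion_congr (μ := (P.map h.config).bind pointKernel)
    (ν := (μ : ℝ≥0∞) • (volume : Measure Plane)) (s := spanningSets (volume : Measure Plane))
  rw [iUnion_spanningSets, Measure.restrict_univ, Measure.restrict_univ] at this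
  refine this.2 fun n => Measure.ext fun B hB => ?_
  have hm := hB.inter (measurableSet_spanningSets (volume : Measure Plane) n)
  rw [Measure.restrict_apply hB, Measure.restrict_apply hB, key _ hm]
  · simp
  · exact ((measure_mono Set.inter_subset_right).trans_lt
      (measure_spanningSets_lt_top volume n)).ne

lemma lintegral_pointKernel (h : IsPoissonProcess Φ μ P) {B : Set Plane}
    (hB : MeasurableSet B) : ∫⁻ ω, pointKernel (h.config ω) B ∂P = μ * volume B := by
  rw [← lintegral_map (pointKernel.measurable_coe hB) h.measurable_config,
    ← Measure.bind_apply hB pointKernel.aemeasurable, h.bind_pointKernel]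
  simp

/-- The counts in disjoint sets are independent, so the mean of their product factorizes. -/
lemma bind_pairKernel_prod (h : IsPoissonProcess Φ μ P) {A B : Set Plane}
    (hA : MeasurableSet A) (hB : MeasurableSet B) (hAB : Disjoint A B) :
    (P.map h.config).bind pairKernel (A ×ˢ B) = (μ * volume A) * (μ * volume B) := by
  have hind : IndepFun (count Φ A) (count Φ B) P := by
    have := h.indep_count 2 ![A, B] (by simp [Fin.forall_fin_two, hA, hB]) (by
      intro i j hij
      fin_cases i <;> fin_cases j <;> simp_all [hAB.symm])
    exact this.indepFun (i := 0) (j := 1) (by simp)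
  rw [Measure.bind_apply (hA.prod hB) pairKernel.aemeasurable,
    lintegral_map (pairKernel.measurable_coe (hA.prod hB)) h.measurable_config,
    ← h.lintegral_pointKernel hA, ← h.lintegral_pointKernel hB]
  simp only [pairKernel_apply_prod, pointKernel_apply_set _ hA, pointKernel_apply_set _ hB]
  exact lintegral_mul_eq_lintegral_mul_lintegral_of_indepFun
    (Measurable.of_discrete.comp (h.measurable_count A hA))
    (Measurable.of_discrete.comp (h.measurable_count B hB))
    (hind.comp (φ := fun n : ℕ∞ => (n : ℝ≥0∞)) (ψ := fun n : ℕ∞ => (n : ℝ≥0∞))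
      .of_discrete .of_discrete)

/-- Off the diagonal, the second moment measure of a Poisson process is the square of its
intensity measure. -/
lemma restrict_bind_pairKernel (h : IsPoissonProcess Φ μ P) :
    ((P.map h.config).bind pairKernel).restrict (Set.diagonal Plane)ᶜ =
      (((μ : ℝ≥0∞) • (volume : Measure Plane)).prod
        ((μ : ℝ≥0∞) • (volume : Measure Plane))).restrict (Set.diagonal Plane)ᶜ := by
  let b := TopologicalSpace.countableBasis Plane
  have hb := TopologicalSpace.isBasis_countableBasis Plane
  let I := {p : b × b // Disjoint (p.1 : Set Plane) p.2}
  have hc : Countable b := (TopologicalSpace.countable_countableBasis Plane).to_subtype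
  -- The complement of the diagonal is a countable union of products of disjoint basic open sets,
  -- and measures that agree on each piece agree on the union.
  have hU : (Set.diagonal Plane)ᶜ = ⋃ p : I, (p.1.1 : Set Plane) ×ˢ (p.1.2 : Set Plane) := by
    ext ⟨x, y⟩
    simp only [Set.mem_compl_iff, Set.mem_diagonal_iff, Set.mem_iUnion, Set.mem_prod]
    constructor
    · intro hxy
      obtain ⟨U, V, hUo, hVo, hxU, hyV, hd⟩ := t2_separation hxy
      obtain ⟨U', hU', hx, hUU⟩ := hb.exists_subset_of_mem_open hxU hUo
      obtain ⟨V', hV', hy, hVV⟩ := hb.exists_subset_of_mem_open hyV hVo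
      exact ⟨⟨(⟨U', hU'⟩, ⟨V', hV'⟩), hd.mono hUU hVV⟩, hx, hy⟩
    · rintro ⟨⟨⟨U, V⟩, hd⟩, hx, hy⟩ rfl
      exact Set.disjoint_left.1 hd hx hy
  rw [hU, Measure.restrict_iUnion_congr]
  rintro ⟨⟨⟨U, hUb⟩, ⟨V, hVb⟩⟩, hd⟩
  have hUm : MeasurableSet U := (hb.isOpen hUb).measurableSet
  have hVm : MeasurableSet V := (hb.isOpen hVb).measurableSet
  simp only at hd ⊢
  have : SigmaFinite (((μ : ℝ≥0∞) • (volume : Measure Plane))) := by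
    change SigmaFinite (μ • (volume : Measure Plane))
    infer_instance
  rw [← Measure.prod_restrict]
  refine (Measure.prod_eq fun s t hs ht => ?_).symm
  rw [Measure.restrict_apply (hs.prod ht), Set.prod_inter_prod,
    h.bind_pairKernel_prod (hs.inter hUm) (ht.inter hVm)
      (hd.mono Set.inter_subset_right Set.inter_subset_right),
    Measure.restrict_apply hs, Measure.restrict_apply ht]
  simp

end IsPoissonProcess

lemma IsPoissonModel.indepFun_config {lam : ℝ≥0} (h : IsPoissonModel Φ Ψ lam P) :
    IndepFun h.nodes.config h.eavesdroppers.config P := by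
  rw [IndepFun_iff_Indep, h.nodes.comap_config, h.eavesdroppers.comap_config]
  exact h.indep

end

/-- Campbell's formula for a random measure and an independent random element. -/
lemma lintegral_kernel_of_indepFun {Ω Ω₁ Ω₂ X : Type*} [MeasurableSpace Ω] [MeasurableSpace Ω₁]
    [MeasurableSpace Ω₂] [MeasurableSpace X] {P : Measure Ω} [IsProbabilityMeasure P]
    {f : Ω → Ω₁} {g : Ω → Ω₂} (hf : Measurable f) (hg : Measurable g) (hfg : IndepFun f g P)
    (K : Kernel Ω₁ X) [IsSFiniteKernel K] {S : Set (X × Ω₂)} (hS : MeasurableSet S) :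
    ∫⁻ ω, K (f ω) {x | (x, g ω) ∈ S} ∂P =
      ∫⁻ x, P {ω | (x, g ω) ∈ S} ∂((P.map f).bind K) := by
  have hT : MeasurableSet {q : (Ω₁ × Ω₂) × X | (q.2, q.1.2) ∈ S} :=
    (measurable_snd.prodMk (measurable_snd.comp measurable_fst)) hS
  have hF : Measurable fun q : Ω₁ × Ω₂ => K q.1 {x | (x, q.2) ∈ S} :=
    Kernel.measurable_kernel_prodMk_left (κ := K.comap Prod.fst measurable_fst) hT
  have := Measure.isProbabilityMeasure_map (μ := P) hf.aemeasurable
  have := Measure.isProbabilityMeasure_map (μ := P) hg.aemeasurable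
  -- By independence the joint law is a product, so Tonelli's theorem allows averaging the random
  -- measure first.
  rw [← lintegral_map (f := fun q : Ω₁ × Ω₂ => K q.1 {x | (x, q.2) ∈ S}) hF (hf.prodMk hg),
    (indepFun_iff_map_prod_eq_prod_map_map hf.aemeasurable hg.aemeasurable).1 hfg,
    lintegral_prod_symm' _ hF]
  have h1 : ∀ b : Ω₂, MeasurableSet {x | (x, b) ∈ S} := fun b => measurable_prodMk_right hS
  have h2 : ∀ x : X, MeasurableSet {b | (x, b) ∈ S} := fun x => measurable_prodMk_left hS
  calc ∫⁻ b, ∫⁻ a, K a {x | (x, b) ∈ S} ∂(P.map f) ∂(P.map g)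
      = ∫⁻ b, (P.map f).bind K {x | (x, b) ∈ S} ∂(P.map g) :=
        lintegral_congr fun b => (Measure.bind_apply (h1 b) K.aemeasurable).symm
    _ = (((P.map f).bind K).prod (P.map g)) S := (Measure.prod_apply_symm hS).symm
    _ = ∫⁻ x, P {ω | (x, g ω) ∈ S} ∂((P.map f).bind K) := by
        rw [Measure.prod_apply hS]
        exact lintegral_congr fun x => Measure.map_apply hg (h2 x)

/-! ### The area of the union of two disks -/

lemma integral_two_mul_sqrt_one_sub_sq :
    ∫ x in (1 / 2 : ℝ)..1, 2 * √(1 - x ^ 2) = Real.pi / 3 - √3 / 4 := by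
  have hd : ∀ x ∈ Set.Ioo (1 / 2 : ℝ) 1,
      HasDerivAt (fun x => x * √(1 - x ^ 2) + Real.arcsin x) (2 * √(1 - x ^ 2)) x := by
    intro x hx
    have hpos : 0 < 1 - x ^ 2 := by nlinarith [hx.1, hx.2]
    have h1 : HasDerivAt (fun x : ℝ => 1 - x ^ 2) (-(2 * x)) x := by
      simpa using (hasDerivAt_pow 2 x).const_sub 1
    have h2 := (hasDerivAt_id x).mul (h1.sqrt hpos.ne')
    have h3 := h2.add (Real.hasDerivAt_arcsin (x := x) (by linarith [hx.1]) hx.2.ne)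
    convert! h3 using 1
    have hs : √(1 - x ^ 2) ≠ 0 := (Real.sqrt_pos.2 hpos).ne'
    have hq : √(1 - x ^ 2) ^ 2 = 1 - x ^ 2 := Real.sq_sqrt hpos.le
    simp only [id]
    field_simp
    rw [hq]
    ring
  -- This form needs the derivative only on the open interval; `arcsin` is not differentiable at
  -- `1`.
  rw [intervalIntegral.integral_eq_sub_of_hasDerivAt_of_le (by norm_num)
    (Continuous.continuousOn (by fun_prop)) hd
    (Continuous.intervalIntegrable (by fun_prop) _ _)]
  have h1 : √(1 - (1 / 2 : ℝ) ^ 2) = √3 / 2 := by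
    rw [show (1 - (1 / 2 : ℝ) ^ 2) = 3 / 2 ^ 2 by norm_num, Real.sqrt_div (by norm_num),
      Real.sqrt_sq (by norm_num)]
  have h2 : Real.arcsin (1 / 2) = Real.pi / 6 := by
    rw [← Real.sin_pi_div_six]
    exact Real.arcsin_sin (by linarith [Real.pi_pos]) (by linarith [Real.pi_pos])
  rw [h1, h2, Real.arcsin_one]
  norm_num
  ring

/-- The intersection of the disks of radius one centred at `0` and `1`, in coordinates. -/
def lens : Set (ℝ × ℝ) := {p | p.1 ^ 2 + p.2 ^ 2 ≤ 1 ∧ (p.1 - 1) ^ 2 + p.2 ^ 2 ≤ 1}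

lemma measurableSet_lens : MeasurableSet lens := by
  have h : lens = {p : ℝ × ℝ | p.1 ^ 2 + p.2 ^ 2 ≤ 1} ∩ {p | (p.1 - 1) ^ 2 + p.2 ^ 2 ≤ 1} := by
    ext p
    rfl
  rw [h]
  exact (measurableSet_le (by fun_prop) measurable_const).inter
    (measurableSet_le (by fun_prop) measurable_const)

lemma volume_lens : volume lens = ENNReal.ofReal (2 * Real.pi / 3 - √3 / 2) := by
  -- The length of the slice at abscissa `a`. As `√` is `0` on negative numbers, empty slices are
  -- covered too. The symmetry `a ↦ 1 - a` later reduces the area to twice the integral over `[1/2,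
  -- 1]`.
  let g : ℝ → ℝ := fun a => 2 * √(1 - max (a ^ 2) ((a - 1) ^ 2))
  have hg : Continuous g := by fun_prop
  have hslice : ∀ a : ℝ, volume (Prod.mk a ⁻¹' lens) = ENNReal.ofReal (g a) := by
    intro a
    have hS : Prod.mk a ⁻¹' lens = {b : ℝ | b ^ 2 ≤ 1 - max (a ^ 2) ((a - 1) ^ 2)} := by
      ext b
      simp only [lens, Set.mem_preimage, Set.mem_ofPred_eq, le_sub_iff_add_le', ← max_add_add_right,
        max_le_iff]
    rw [hS]
    rcases lt_or_ge (1 - max (a ^ 2) ((a - 1) ^ 2)) 0 with hm | hm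
    · have : {b : ℝ | b ^ 2 ≤ 1 - max (a ^ 2) ((a - 1) ^ 2)} = ∅ := by
        ext b
        simp only [Set.mem_ofPred_eq, Set.mem_empty_iff_false, iff_false, not_le]
        exact hm.trans_le (sq_nonneg b)
      simp [this, g, Real.sqrt_eq_zero_of_nonpos hm.le]
    · have : {b : ℝ | b ^ 2 ≤ 1 - max (a ^ 2) ((a - 1) ^ 2)} =
          Set.Icc (-√(1 - max (a ^ 2) ((a - 1) ^ 2))) (√(1 - max (a ^ 2) ((a - 1) ^ 2))) := by
        ext b
        simp only [Set.mem_ofPred_eq, Set.mem_Icc]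
        rw [← abs_le, Real.le_sqrt (abs_nonneg b) hm, sq_abs]
      rw [this, Real.volume_Icc]
      congr 1
      simp only [g]
      ring
  rw [Measure.volume_eq_prod, Measure.prod_apply measurableSet_lens]
  simp only [hslice]
  have h0 : ∫⁻ a, ENNReal.ofReal (g a) = ∫⁻ a in Set.Ioc 0 1, ENNReal.ofReal (g a) := by
    rw [← lintegral_indicator measurableSet_Ioc]
    refine lintegral_congr fun a => ?_
    by_cases ha : a ∈ Set.Ioc (0 : ℝ) 1
    · rw [Set.indicator_of_mem ha]
    · rw [Set.indicator_of_notMem ha]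
      have : 1 - max (a ^ 2) ((a - 1) ^ 2) ≤ 0 := by
        rw [sub_nonpos, le_max_iff]
        rw [Set.mem_Ioc, not_and_or, not_lt, not_le] at ha
        rcases ha with ha | ha
        · right; nlinarith
        · left; nlinarith
      simp [g, Real.sqrt_eq_zero_of_nonpos this]
  rw [h0, ← ofReal_integral_eq_lintegral_ofReal
    (hg.integrableOn_Ioc) (ae_of_all _ fun a => by positivity),
    ← intervalIntegral.integral_of_le zero_le_one]
  congr 1
  have h1 : ∫ a in (1 / 2 : ℝ)..1, g a = Real.pi / 3 - √3 / 4 := by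
    rw [← integral_two_mul_sqrt_one_sub_sq]
    refine intervalIntegral.integral_congr fun a ha => ?_
    rw [Set.uIcc_of_le (by norm_num)] at ha
    simp only [g]
    rw [max_eq_left (by nlinarith [ha.1])]
  have h2 : ∫ a in (0 : ℝ)..(1 / 2), g a = ∫ a in (1 / 2 : ℝ)..1, g a := by
    have := intervalIntegral.integral_comp_sub_left (a := 0) (b := 1 / 2) g 1
    rw [show (1 : ℝ) - 1 / 2 = 1 / 2 by norm_num, sub_zero] at this
    rw [← this]
    refine intervalIntegral.integral_congr fun a _ => ?_
    simp only [g]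
    rw [max_comm]
    congr 3
    ring_nf
  rw [← intervalIntegral.integral_add_adjacent_intervals (b := 1 / 2)
    (hg.intervalIntegrable _ _) (hg.intervalIntegrable _ _), h2, h1]
  ring

lemma volume_complex_lens :
    volume (Metric.closedBall (0 : ℂ) 1 ∩ Metric.closedBall 1 1) =
      ENNReal.ofReal (2 * Real.pi / 3 - √3 / 2) := by
  rw [← volume_lens, ← Complex.volume_preserving_equiv_real_prod.measure_preimage
    measurableSet_lens.nullMeasurableSet]
  congr 1
  ext z
  simp only [Set.mem_inter_iff, Metric.mem_closedBall, Complex.dist_eq, Set.mem_preimage, lens,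
    Set.mem_ofPred_eq, Complex.measurableEquivRealProd_apply, sub_zero]
  rw [← sq_le_one_iff₀ (norm_nonneg _), ← sq_le_one_iff₀ (norm_nonneg (z - 1)), Complex.sq_norm,
    Complex.sq_norm, Complex.normSq_apply, Complex.normSq_apply]
  simp only [Complex.sub_re, Complex.sub_im, Complex.one_re, Complex.one_im, sub_zero, sq]

/-- A linear isometry from the complex plane that maps `1` to a given unit vector. -/
lemma exists_linearIsometryEquiv_one {u : Plane} (hu : ‖u‖ = 1) :
    ∃ f : ℂ ≃ₗᵢ[ℝ] Plane, f 1 = u := by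
  let f₀ := Complex.orthonormalBasisOneI.repr
  have ha : ‖f₀.symm u‖ = 1 := by rw [LinearIsometryEquiv.norm_map, hu]
  let a : Circle := ⟨f₀.symm u, by exact mem_sphere_zero_iff_norm.2 ha⟩
  refine ⟨(rotation a).trans f₀, ?_⟩
  rw [LinearIsometryEquiv.trans_apply, rotation_apply, mul_one]
  exact f₀.apply_symm_apply u

open Pointwise in
-- A similarity of ratio `dist x y` carries the unit lens with centres `0`, `1` to this one and
-- multiplies areas by `dist x y ^ 2`.
lemma volume_closedBall_inter_closedBall (x y : Plane) :
    volume (Metric.closedBall x (dist x y) ∩ Metric.closedBall y (dist x y)) =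
      ENNReal.ofReal ((2 * Real.pi / 3 - √3 / 2) * dist x y ^ 2) := by
  rcases eq_or_ne x y with rfl | hxy
  · simp
  set R := dist x y with hR
  have hRpos : 0 < R := dist_pos.2 hxy
  have hyR : ‖y - x‖ = R := by rw [hR, dist_comm, dist_eq_norm]
  obtain ⟨f, hf⟩ := exists_linearIsometryEquiv_one (u := R⁻¹ • (y - x)) (by
    rw [norm_smul, hyR, norm_inv, Real.norm_of_nonneg hRpos.le, inv_mul_cancel₀ hRpos.ne'])
  let L : Set ℂ := Metric.closedBall (0 : ℂ) 1 ∩ Metric.closedBall 1 1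
  have hL : MeasurableSet L :=
    Metric.isClosed_closedBall.measurableSet.inter Metric.isClosed_closedBall.measurableSet
  have hset : Metric.closedBall x R ∩ Metric.closedBall y R =
      (fun w => w + (-x)) ⁻¹' (R • (f.symm ⁻¹' L)) := by
    ext w
    have h0 : ‖f.symm (R⁻¹ • (w + -x))‖ = R⁻¹ * dist w x := by
      rw [LinearIsometryEquiv.norm_map, norm_smul, norm_inv, Real.norm_of_nonneg hRpos.le,
        dist_eq_norm, sub_eq_add_neg]
    have h1 : dist (f.symm (R⁻¹ • (w + -x))) 1 = R⁻¹ * dist w y := by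
      rw [← f.dist_map, f.apply_symm_apply, hf, dist_eq_norm, ← smul_sub, norm_smul, norm_inv,
        Real.norm_of_nonneg hRpos.le, dist_eq_norm]
      congr 2
      abel
    rw [Set.mem_preimage, Set.mem_smul_set_iff_inv_smul_mem₀ hRpos.ne']
    simp only [L, Set.mem_inter_iff, Set.mem_preimage, Metric.mem_closedBall, h1, dist_zero_right,
      h0]
    rw [inv_mul_le_iff₀ hRpos, inv_mul_le_iff₀ hRpos, mul_one]
  rw [hset, measure_preimage_add_right, Measure.addHaar_smul,
    f.symm.measurePreserving.measure_preimage hL.nullMeasurableSet, volume_complex_lens,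
    ← ENNReal.ofReal_mul (abs_nonneg _)]
  congr 1
  rw [finrank_euclideanSpace_fin, abs_of_nonneg (by positivity)]
  ring

lemma volume_closedBall_dist (x : Plane) {R : ℝ} (hR : 0 ≤ R) :
    (volume (Metric.closedBall x R)).toReal = Real.pi * R ^ 2 := by
  rw [EuclideanSpace.volume_closedBall_fin_two, ENNReal.toReal_mul, ENNReal.toReal_pow,
    ENNReal.toReal_ofReal hR, ENNReal.toReal_ofReal Real.pi_pos.le]
  ring

/-- Inclusion-exclusion: in units of the disk area, `2 - (2/3 - √3/(2π)) = c`. -/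
lemma volume_closedBall_union_closedBall (x y : Plane) :
    (volume (Metric.closedBall x (dist x y) ∪ Metric.closedBall y (dist x y))).toReal =
      c * (Real.pi * dist x y ^ 2) := by
  have h := measureReal_union_add_inter (μ := (volume : Measure Plane))
    (s := Metric.closedBall x (dist x y)) (t := Metric.closedBall y (dist x y))
    Metric.isClosed_closedBall.measurableSet
    measure_closedBall_lt_top.ne measure_closedBall_lt_top.ne
  simp only [measureReal_def, volume_closedBall_dist _ dist_nonneg,
    volume_closedBall_inter_closedBall] at h
  have hpi := Real.pi_gt_three
  have hs : √3 ≤ 2 := by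
    rw [Real.sqrt_le_left (by norm_num)]; norm_num
  rw [ENNReal.toReal_ofReal (mul_nonneg (by linarith) (sq_nonneg _))] at h
  rw [eq_sub_of_add_eq h, c]
  field_simp
  ring

/-! ### Radial integrals -/

/-- The points with `π‖x‖² ≤ t` form a disk of area exactly `t`, and the half-lines `Iic t`
determine the measure. This replaces polar coordinates. -/
lemma map_pi_mul_norm_sq :
    (volume : Measure Plane).map (fun x => Real.pi * ‖x‖ ^ 2) =
      (volume : Measure ℝ).restrict (Set.Ici 0) := by
  have hm : Measurable fun x : Plane => Real.pi * ‖x‖ ^ 2 := by fun_prop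
  have hI : ∀ t : ℝ, (volume : Measure Plane).map (fun x => Real.pi * ‖x‖ ^ 2) (Set.Iic t) =
      ENNReal.ofReal t := by
    intro t
    rw [Measure.map_apply hm measurableSet_Iic]
    rcases lt_or_ge t 0 with ht | ht
    · have : (fun x : Plane => Real.pi * ‖x‖ ^ 2) ⁻¹' Set.Iic t = ∅ := by
        ext x
        simp only [Set.mem_preimage, Set.mem_Iic, Set.mem_empty_iff_false, iff_false, not_le]
        exact ht.trans_le (by positivity)
      rw [this, measure_empty, ENNReal.ofReal_of_nonpos ht.le]
    · have : (fun x : Plane => Real.pi * ‖x‖ ^ 2) ⁻¹' Set.Iic t =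
          Metric.closedBall 0 √(t / Real.pi) := by
        ext x
        simp only [Set.mem_preimage, Set.mem_Iic, Metric.mem_closedBall, dist_zero_right]
        rw [Real.le_sqrt (norm_nonneg _) (by positivity), le_div_iff₀ Real.pi_pos, mul_comm]
      rw [this, ← ENNReal.ofReal_toReal (measure_closedBall_lt_top.ne),
        volume_closedBall_dist _ (Real.sqrt_nonneg _), Real.sq_sqrt (by positivity)]
      congr 1
      field_simp
  refine Measure.ext_of_generateFrom_of_iUnion (Set.range Set.Iic) (fun n : ℕ => Set.Iic (n : ℝ))
    ?_ isPiSystem_Iic ?_ (fun n => ⟨_, rfl⟩) (fun n => ?_) ?_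
  · rw [← borel_eq_generateFrom_Iic]; exact BorelSpace.measurable_eq
  · ext x
    simpa using exists_nat_ge x
  · rw [hI]; exact ENNReal.ofReal_ne_top
  · rintro _ ⟨t, rfl⟩
    rw [hI, Measure.restrict_apply measurableSet_Iic, Set.inter_comm, Set.Ici_inter_Iic,
      Real.volume_Icc, sub_zero]

lemma lintegral_comp_pi_mul_norm_sq {g : ℝ → ℝ≥0∞} (hg : Measurable g) :
    ∫⁻ x : Plane, g (Real.pi * ‖x‖ ^ 2) = ∫⁻ t in Set.Ici 0, g t := by
  rw [← map_pi_mul_norm_sq, lintegral_map hg (by fun_prop)]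

lemma one_lt_c : 1 < c := by
  have : 0 ≤ √3 / (2 * Real.pi) := by positivity
  rw [c]
  linarith

/-! ### The ratio function -/

/-- The function `exp (-π t)` of `t` in `[0, ∞]`. -/
noncomputable def expNeg (t : ℝ≥0∞) : ℝ := if t = ∞ then 0 else Real.exp (-(Real.pi * t.toReal))

lemma expNeg_top : expNeg ∞ = 0 := if_pos rfl

lemma expNeg_of_ne_top {t : ℝ≥0∞} (ht : t ≠ ∞) :
    expNeg t = Real.exp (-(Real.pi * t.toReal)) := if_neg ht

lemma expNeg_zero : expNeg 0 = 1 := by simp [expNeg]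

lemma expNeg_nonneg (t : ℝ≥0∞) : 0 ≤ expNeg t := by
  rw [expNeg]
  split_ifs <;> positivity

lemma expNeg_strictAnti : StrictAnti expNeg := by
  intro s t hst
  have hs : s ≠ ∞ := hst.ne_top
  rw [expNeg_of_ne_top hs]
  by_cases ht : t = ∞
  · rw [ht, expNeg_top]
    positivity
  · rw [expNeg_of_ne_top ht, Real.exp_lt_exp, neg_lt_neg_iff]
    exact mul_lt_mul_of_pos_left ((ENNReal.toReal_lt_toReal hs ht).2 hst) Real.pi_pos

lemma expNeg_le_one (t : ℝ≥0∞) : expNeg t ≤ 1 :=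
  expNeg_zero ▸ expNeg_strictAnti.antitone (zero_le (a := t))

lemma expNeg_lt_one {t : ℝ≥0∞} (ht : t ≠ 0) : expNeg t < 1 :=
  expNeg_zero ▸ expNeg_strictAnti (pos_iff_ne_zero.2 ht)

lemma tendsto_expNeg_zero : Tendsto expNeg (𝓝 0) (𝓝 1) := by
  have h1 : Tendsto (fun t : ℝ≥0∞ => Real.exp (-(Real.pi * t.toReal))) (𝓝 0) (𝓝 1) := by
    have h := ENNReal.tendsto_toReal (a := 0) ENNReal.zero_ne_top
    have h2 := (Real.continuous_exp.tendsto _).comp ((h.const_mul Real.pi).neg)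
    simpa [Function.comp_def] using h2
  refine h1.congr' ?_
  filter_upwards [Iio_mem_nhds (ENNReal.zero_lt_top)] with t ht
  exact (expNeg_of_ne_top (ne_of_lt ht)).symm

lemma tendsto_expNeg_top : Tendsto expNeg (𝓝 ∞) (𝓝 0) := by
  rw [Metric.tendsto_nhds]
  intro ε hε
  have h1 : Tendsto (fun M : ℝ => Real.exp (-(Real.pi * M))) atTop (𝓝 0) :=
    Real.tendsto_exp_neg_atTop_nhds_zero.comp (tendsto_id.const_mul_atTop Real.pi_pos)
  obtain ⟨M, hM, hM0⟩ := ((h1.eventually (gt_mem_nhds hε)).and (eventually_ge_atTop 0)).exists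
  filter_upwards [Ioi_mem_nhds (ENNReal.ofReal_lt_top (r := M))] with t ht
  rw [Real.dist_eq, sub_zero, abs_of_nonneg (expNeg_nonneg t)]
  refine (expNeg_strictAnti ht).trans ?_
  rwa [expNeg_of_ne_top ENNReal.ofReal_ne_top, ENNReal.toReal_ofReal hM0]

/-- The slope `(1 - u ^ c) / (1 - u)` of the power function, normalized to be `1` at `u = 1`. -/
noncomputable def powSlope (u : ℝ) : ℝ := dslope (fun u : ℝ => u ^ c) 1 u / c

lemma hasDerivAt_rpow_c_one : HasDerivAt (fun u : ℝ => u ^ c) c 1 := by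
  simpa using Real.hasDerivAt_rpow_const (x := 1) (p := c) (Or.inl one_ne_zero)

lemma powSlope_one : powSlope 1 = 1 := by
  rw [powSlope, dslope_same, hasDerivAt_rpow_c_one.deriv,
    div_self (zero_lt_one.trans one_lt_c).ne']

lemma powSlope_of_ne {u : ℝ} (hu : u ≠ 1) : powSlope u = (u ^ c - 1) / (u - 1) / c := by
  rw [powSlope, dslope_of_ne _ hu, slope_def_field, Real.one_rpow]

lemma powSlope_zero : powSlope 0 = c⁻¹ := by
  rw [powSlope_of_ne zero_ne_one, Real.zero_rpow (zero_lt_one.trans one_lt_c).ne']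
  norm_num

/-- Secant slopes through `1` of the strictly convex `u ^ c` increase. At the endpoint `1`, where
the slope is a derivative, this is Bernoulli's inequality. -/
lemma powSlope_strictMonoOn : StrictMonoOn powSlope (Set.Icc 0 1) := by
  intro u hu v hv huv
  have hc := one_lt_c
  have hu1 : u < 1 := huv.trans_le hv.2
  rcases eq_or_lt_of_le hv.2 with rfl | hv1
  · rw [powSlope_one, powSlope_of_ne hu1.ne, div_lt_one (by linarith),
      div_lt_iff_of_neg (by linarith)]
    have := one_add_mul_self_lt_rpow_one_add (s := u - 1) (by linarith [hu.1]) (by linarith) hc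
    rw [add_sub_cancel] at this
    linarith
  · rw [powSlope_of_ne hu1.ne, powSlope_of_ne hv1.ne]
    have := (strictConvexOn_rpow hc).secant_strict_mono (a := 1) (x := u) (y := v)
      (Set.mem_Ici.2 zero_le_one) hu.1 hv.1 hu1.ne hv1.ne huv
    simp only [Real.one_rpow] at this
    exact div_lt_div_of_pos_right this (by linarith)

lemma tendsto_powSlope_one : Tendsto powSlope (𝓝 1) (𝓝 1) := by
  have h := (continuousAt_dslope_same.2 hasDerivAt_rpow_c_one.differentiableAt).div_const c
  have h1 : Tendsto powSlope (𝓝 1) (𝓝 (powSlope 1)) := h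
  rwa [powSlope_one] at h1

lemma tendsto_powSlope_zero : Tendsto powSlope (𝓝 0) (𝓝 c⁻¹) := by
  have h0 : ContinuousAt (fun u : ℝ => u ^ c) 0 :=
    Real.continuousAt_rpow_const _ _ (Or.inr (zero_lt_one.trans one_lt_c).le)
  have h := (((continuousAt_dslope_of_ne (a := (1 : ℝ)) (b := 0) zero_ne_one).2 h0)).div_const c
  have h1 : Tendsto powSlope (𝓝 0) (𝓝 (powSlope 0)) := h
  rwa [powSlope_zero] at h1

lemma powSlope_mem {u : ℝ} (hu : u ∈ Set.Icc (0 : ℝ) 1) : powSlope u ∈ Set.Icc c⁻¹ 1 :=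
  ⟨powSlope_zero ▸ powSlope_strictMonoOn.monotoneOn (by simp) hu hu.1,
    powSlope_one ▸ powSlope_strictMonoOn.monotoneOn hu (by simp) hu.2⟩

lemma expNeg_mem (t : ℝ≥0∞) : expNeg t ∈ Set.Icc (0 : ℝ) 1 := ⟨expNeg_nonneg t, expNeg_le_one t⟩

/-- The ratio of the mean degrees of the basic and the enhanced secrecy graph. -/
noncomputable def degreeRatio (t : ℝ≥0∞) : ℝ :=
  powSlope (expNeg t) / (2 - powSlope (expNeg t))

/-- The map `k ↦ k / (2 - k)` increases on `k ≤ 1`, `powSlope` increases and `expNeg` decreases. -/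
lemma degreeRatio_strictAnti : StrictAnti degreeRatio := by
  intro s t hst
  have h1 := powSlope_strictMonoOn (expNeg_mem t) (expNeg_mem s) (expNeg_strictAnti hst)
  have hs := powSlope_mem (expNeg_mem s)
  have ht := powSlope_mem (expNeg_mem t)
  rw [degreeRatio, degreeRatio, div_lt_div_iff₀ (by linarith [ht.2]) (by linarith [hs.2])]
  linarith

lemma degreeRatio_zero : degreeRatio 0 = 1 := by
  rw [degreeRatio, expNeg_zero, powSlope_one]
  norm_num

lemma div_two_sub_inv_c : c⁻¹ / (2 - c⁻¹) = (2 * c - 1)⁻¹ := by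
  have hc := one_lt_c
  have h1 : 2 * c - 1 ≠ 0 := by linarith
  have h2 : 2 - c⁻¹ ≠ 0 := by
    have := inv_lt_one_of_one_lt₀ hc
    linarith
  field_simp

lemma degreeRatio_top : degreeRatio ∞ = (2 * c - 1)⁻¹ := by
  rw [degreeRatio, expNeg_top, powSlope_zero, div_two_sub_inv_c]

lemma tendsto_degreeRatio_zero : Tendsto degreeRatio (𝓝 0) (𝓝 1) := by
  have h := tendsto_powSlope_one.comp tendsto_expNeg_zero
  have := h.div (h.const_sub 2) (by norm_num)
  norm_num at this
  exact this

lemma tendsto_degreeRatio_top : Tendsto degreeRatio (𝓝 ∞) (𝓝 (2 * c - 1)⁻¹) := by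
  have h := tendsto_powSlope_zero.comp tendsto_expNeg_top
  have := h.div (h.const_sub 2) (by
    have := inv_lt_one_of_one_lt₀ one_lt_c
    linarith)
  rw [div_two_sub_inv_c] at this
  exact this

/-! ### The mean degrees -/

/-- The integral of `exp (-κ π ‖x‖ ^ 2)` over the disk of radius `r`. -/
noncomputable def gaussDisk (κ : ℝ) (r : ℝ≥0∞) : ℝ≥0∞ :=
  ∫⁻ x : Plane in {x | edist 0 x ≤ r}, ENNReal.ofReal (Real.exp (-(κ * (Real.pi * ‖x‖ ^ 2))))

lemma measurableSet_edist_le (r : ℝ≥0∞) : MeasurableSet {x : Plane | edist 0 x ≤ r} :=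
  measurableSet_le (by fun_prop) measurable_const

lemma gaussDisk_zero {r : ℝ≥0∞} (hr : r ≠ ∞) :
    gaussDisk 0 r = ENNReal.ofReal (Real.pi * r.toReal ^ 2) := by
  have h : {x : Plane | edist 0 x ≤ r} = Metric.closedBall 0 r.toReal := by
    ext x
    rw [Set.mem_ofPred_eq, Metric.mem_closedBall, dist_comm, edist_dist,
      ENNReal.ofReal_le_iff_le_toReal hr]
  rw [gaussDisk, h, ← volume_closedBall_dist 0 ENNReal.toReal_nonneg,
    ENNReal.ofReal_toReal measure_closedBall_lt_top.ne]
  simp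

lemma gaussDisk_top {κ : ℝ} (hκ : 0 < κ) : gaussDisk κ ∞ = ENNReal.ofReal κ⁻¹ := by
  have h : {x : Plane | edist 0 x ≤ ∞} = Set.univ := by
    ext x
    simp
  rw [gaussDisk, h, Measure.restrict_univ,
    lintegral_comp_pi_mul_norm_sq (g := fun t => ENNReal.ofReal (Real.exp (-(κ * t))))
      (by fun_prop), restrict_Ioi_eq_restrict_Ici.symm]
  have hi : IntegrableOn (fun t : ℝ => Real.exp (-(κ * t))) (Set.Ioi 0) := by
    simpa only [neg_mul] using integrableOn_exp_mul_Ioi (neg_lt_zero.2 hκ) 0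
  rw [← ofReal_integral_eq_lintegral_ofReal hi (ae_of_all _ fun t => (Real.exp_pos _).le)]
  congr 1
  simpa using integral_exp_mul_Ioi (neg_lt_zero.2 hκ) 0

lemma gaussDisk_of_ne_top {κ : ℝ} (hκ : 0 < κ) {r : ℝ≥0∞} (hr : r ≠ ∞) :
    gaussDisk κ r = ENNReal.ofReal ((1 - Real.exp (-(κ * (Real.pi * r.toReal ^ 2)))) / κ) := by
  set T := Real.pi * r.toReal ^ 2 with hT
  have hT0 : 0 ≤ T := by positivity
  have h : ∀ x : Plane, edist 0 x ≤ r ↔ Real.pi * ‖x‖ ^ 2 ≤ T := by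
    intro x
    rw [edist_dist, dist_zero_left, ENNReal.ofReal_le_iff_le_toReal hr, hT,
      mul_le_mul_iff_of_pos_left Real.pi_pos, sq_le_sq₀ (norm_nonneg _) ENNReal.toReal_nonneg]
  rw [gaussDisk, ← lintegral_indicator (measurableSet_edist_le r)]
  have h2 : ∀ x : Plane, {x : Plane | edist 0 x ≤ r}.indicator (fun x =>
      ENNReal.ofReal (Real.exp (-(κ * (Real.pi * ‖x‖ ^ 2))))) x =
      (Set.Iic T).indicator (fun t => ENNReal.ofReal (Real.exp (-(κ * t)))) (Real.pi * ‖x‖ ^ 2) := by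
    intro x
    by_cases hx : edist 0 x ≤ r
    · rw [Set.indicator_of_mem (show x ∈ {x : Plane | edist 0 x ≤ r} from hx),
        Set.indicator_of_mem (Set.mem_Iic.2 ((h x).1 hx))]
    · rw [Set.indicator_of_notMem (show x ∉ {x : Plane | edist 0 x ≤ r} from hx),
        Set.indicator_of_notMem (fun h' => hx ((h x).2 (Set.mem_Iic.1 h')))]
  rw [lintegral_congr h2, lintegral_comp_pi_mul_norm_sq
    (Measurable.indicator (by fun_prop) measurableSet_Iic),
    lintegral_indicator measurableSet_Iic, Measure.restrict_restrict measurableSet_Iic,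
    Set.inter_comm, Set.Ici_inter_Iic, ← restrict_Ioc_eq_restrict_Icc,
    ← ofReal_integral_eq_lintegral_ofReal (Continuous.integrableOn_Ioc (by fun_prop))
      (ae_of_all _ fun t => (Real.exp_pos _).le), ← intervalIntegral.integral_of_le hT0]
  congr 1
  have hd : ∀ t ∈ Set.uIcc 0 T,
      HasDerivAt (fun t : ℝ => -(Real.exp (-(κ * t)) / κ)) (Real.exp (-(κ * t))) t := by
    intro t _
    have h1 : HasDerivAt (fun t : ℝ => -(κ * t)) (-κ) t := by
      simpa only [neg_mul] using hasDerivAt_const_mul (x := t) (-κ)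
    convert! (h1.exp.div_const κ).neg using 1
    field_simp
  rw [intervalIntegral.integral_eq_sub_of_hasDerivAt hd
    (Continuous.intervalIntegrable (by fun_prop) _ _)]
  simp only [mul_zero, neg_zero, Real.exp_zero]
  ring

/-- One formula for finite and infinite `r`, since `0 ^ a = 0`. It is used with `a = 1` (one disk)
and `a = c` (the union of two). -/
lemma gaussDisk_eq {lam : ℝ≥0} (hlam : lam ≠ 0) {a : ℝ} (ha : 0 < a) (r : ℝ≥0∞) :
    gaussDisk (lam * a) r = ENNReal.ofReal ((1 - expNeg (lam * r ^ 2) ^ a) / (lam * a)) := by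
  have hl : (0 : ℝ) < lam := by exact_mod_cast pos_iff_ne_zero.2 hlam
  by_cases hr : r = ∞
  · have : (lam : ℝ≥0∞) * ∞ ^ 2 = ∞ := by
      rw [ENNReal.top_pow two_ne_zero, ENNReal.mul_top (by exact_mod_cast hlam)]
    rw [hr, gaussDisk_top (by positivity), this, expNeg_top, Real.zero_rpow ha.ne', sub_zero,
      one_div]
  · rw [gaussDisk_of_ne_top (by positivity) hr, expNeg_of_ne_top
      (ENNReal.mul_ne_top ENNReal.coe_ne_top (ENNReal.pow_ne_top hr)), ← Real.exp_mul]
    simp only [ENNReal.toReal_mul, ENNReal.coe_toReal, ENNReal.toReal_pow]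
    congr 5
    ring

/-- The quotient of the two integrals depends on `lam * r ^ 2` only. Without eavesdroppers both
equal the area of the disk, matching the value `powSlope 1 = 1`. -/
lemma exists_gaussDisk_eq {lam : ℝ≥0} {r : ℝ≥0∞} (hr : r ≠ 0) (h : lam ≠ 0 ∨ r ≠ ∞) :
    ∃ A : ℝ, 0 < A ∧ gaussDisk lam r = ENNReal.ofReal A ∧
      gaussDisk (lam * c) r = ENNReal.ofReal (A * powSlope (expNeg (lam * r ^ 2))) := by
  by_cases hlam : lam = 0
  · have hr' : r ≠ ∞ := h.resolve_left (not_not.2 hlam)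
    have hpos := ENNReal.toReal_pos hr hr'
    refine ⟨Real.pi * r.toReal ^ 2, by positivity, ?_, ?_⟩
    · simp [hlam, gaussDisk_zero hr']
    · simp [hlam, gaussDisk_zero hr', expNeg_zero, powSlope_one]
  · have hl : (0 : ℝ) < lam := by exact_mod_cast pos_iff_ne_zero.2 hlam
    have ht : (lam : ℝ≥0∞) * r ^ 2 ≠ 0 := mul_ne_zero (by exact_mod_cast hlam) (pow_ne_zero 2 hr)
    have hu := expNeg_lt_one ht
    refine ⟨(1 - expNeg (lam * r ^ 2)) / lam, div_pos (by linarith) hl, ?_, ?_⟩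
    · have := gaussDisk_eq hlam one_pos r
      rwa [mul_one, Real.rpow_one] at this
    · rw [gaussDisk_eq hlam (zero_lt_one.trans one_lt_c), powSlope_of_ne hu.ne]
      congr 1
      have h1 : expNeg (lam * r ^ 2) - 1 ≠ 0 := by linarith
      have hc : c ≠ 0 := (zero_lt_one.trans one_lt_c).ne'
      field_simp
      ring

/-- With the integrals equal to `A` and `A k`, the relation `E + A k = 2 A` forces `E = A (2 - k)`,
which is positive and finite because `k ≤ 1`. -/
lemma gaussDisk_div {lam : ℝ≥0} {r : ℝ≥0∞} (hr : r ≠ 0) (h : lam ≠ 0 ∨ r ≠ ∞) {E : ℝ≥0∞}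
    (hE : E + gaussDisk (lam * c) r = 2 * gaussDisk lam r) :
    E ≠ 0 ∧ E ≠ ∞ ∧ gaussDisk (lam * c) r / E = ENNReal.ofReal (degreeRatio (lam * r ^ 2)) := by
  obtain ⟨A, hA, h1, h2⟩ := exists_gaussDisk_eq hr h
  set k := powSlope (expNeg (lam * r ^ 2)) with hk
  have hkm := powSlope_mem (expNeg_mem (lam * r ^ 2))
  rw [← hk] at hkm
  have hk0 : 0 < k := (inv_pos.2 (zero_lt_one.trans one_lt_c)).trans_le hkm.1
  have hk2 : 0 < 2 - k := by linarith [hkm.2]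
  have hE' : E = ENNReal.ofReal (A * (2 - k)) := by
    rw [← ENNReal.add_left_inj (ENNReal.ofReal_ne_top (r := A * k)), ← h2, hE, h1, h2,
      ← ENNReal.ofReal_add (by positivity) (by positivity), ← ENNReal.ofReal_ofNat,
      ← ENNReal.ofReal_mul (by norm_num)]
    congr 1
    ring
  have hpos : 0 < A * (2 - k) := by positivity
  refine ⟨?_, ?_, ?_⟩
  · rw [hE']
    exact (ENNReal.ofReal_pos.2 hpos).ne'
  · rw [hE']
    exact ENNReal.ofReal_ne_top
  · rw [hE', h2, ← ENNReal.ofReal_div_of_pos hpos, degreeRatio, mul_div_mul_left _ _ hA.ne']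

/-! ### Counting edges -/

/-- Every edge has two orientations. A well-order of the plane selects one of them, which splits the
ordered pairs into two halves swapped by `Prod.swap`; infinite counts are included. -/
lemma two_mul_edgeCount (G : SimpleGraph Plane) (B : Set Plane) :
    2 * edgeCount G B =
      {p : Plane × Plane | G.Adj p.1 p.2 ∧ midpoint ℝ p.1 p.2 ∈ B}.encard := by
  let lt : Plane → Plane → Prop := WellOrderingRel
  have hasymm : ∀ x y, lt x y → ¬ lt y x := fun x y => asymm
  let O : Set (Plane × Plane) := {p | G.Adj p.1 p.2 ∧ midpoint ℝ p.1 p.2 ∈ B}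
  have hswap : ∀ p, p ∈ O → p.swap ∈ O := fun p hp =>
    ⟨hp.1.symm, by rw [Prod.fst_swap, Prod.snd_swap, midpoint_comm]; exact hp.2⟩
  let O₁ : Set (Plane × Plane) := {p ∈ O | lt p.1 p.2}
  have hO : O = O₁ ∪ Prod.swap '' O₁ := by
    ext p
    constructor
    · intro hp
      rcases trichotomous_of lt p.1 p.2 with h | h | h
      · exact Or.inl ⟨hp, h⟩
      · exact absurd h hp.1.ne
      · exact Or.inr ⟨p.swap, ⟨hswap p hp, h⟩, Prod.swap_swap p⟩
    · rintro (hp | ⟨q, hq, rfl⟩)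
      · exact hp.1
      · exact hswap q hq.1
  have hdisj : Disjoint O₁ (Prod.swap '' O₁) := by
    rw [Set.disjoint_left]
    rintro p hp ⟨q, hq, rfl⟩
    exact hasymm _ _ hp.2 hq.2
  have hE : {e : Sym2 Plane | ∃ x y, e = s(x, y) ∧ G.Adj x y ∧ midpoint ℝ x y ∈ B} =
      (fun p : Plane × Plane => s(p.1, p.2)) '' O₁ := by
    ext e
    constructor
    · rintro ⟨x, y, rfl, h⟩
      have hp : (x, y) ∈ O := h
      rw [hO] at hp
      rcases hp with hp | ⟨q, hq, hqp⟩
      · exact ⟨(x, y), hp, rfl⟩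
      · refine ⟨q, hq, ?_⟩
        obtain ⟨rfl, rfl⟩ := Prod.mk.inj hqp
        exact Sym2.eq_swap
    · rintro ⟨p, hp, rfl⟩
      exact ⟨p.1, p.2, rfl, hp.1⟩
  have hinj : Set.InjOn (fun p : Plane × Plane => s(p.1, p.2)) O₁ := by
    intro p hp q hq hpq
    rcases Sym2.eq_iff.1 hpq with h | h
    · exact Prod.ext h.1 h.2
    · refine absurd hp.2 (hasymm _ _ ?_)
      rw [h.1, h.2]
      exact hq.2
  change _ = O.encard
  rw [edgeCount, hE, hinj.encard_image, hO, Set.encard_union_eq hdisj,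
    Prod.swap_injective.encard_image, two_mul]

/-! ### Secrecy in both directions or in one of them -/

/-- The pairs that are secure in both directions. -/
def bothSecure : Set ((Plane × Plane) × Config) :=
  securePairs ∩ {q | (q.1.swap, q.2) ∈ securePairs}

/-- The pairs that are secure in at least one direction. -/
def eitherSecure : Set ((Plane × Plane) × Config) :=
  securePairs ∪ {q | (q.1.swap, q.2) ∈ securePairs}

lemma measurableSet_swap_securePairs :
    MeasurableSet {q : (Plane × Plane) × Config | (q.1.swap, q.2) ∈ securePairs} :=
  ((measurable_swap.comp measurable_fst).prodMk measurable_snd) measurableSet_securePairs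

lemma measurableSet_bothSecure : MeasurableSet bothSecure :=
  measurableSet_securePairs.inter measurableSet_swap_securePairs

lemma measurableSet_eitherSecure : MeasurableSet eitherSecure :=
  measurableSet_securePairs.union measurableSet_swap_securePairs

lemma basicGraph_adj (φ : Set Plane) (r : ℝ≥0∞) (ψ : Config) (x y : Plane) :
    (basicGraph (diskGraph φ r) ψ.points).Adj x y ↔
      (x ≠ y ∧ x ∈ φ ∧ y ∈ φ ∧ edist x y ≤ r) ∧ ((x, y), ψ) ∈ bothSecure := by
  change ((diskGraph φ r).Adj x y ∧ _) ∧ ((diskGraph φ r).Adj y x ∧ _) ↔ (diskGraph φ r).Adj x y ∧ _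
  rw [(diskGraph φ r).adj_comm y x]
  exact ⟨fun h => ⟨h.1.1, h.1.2, h.2.2⟩, fun h => ⟨⟨h.1, h.2.1⟩, h.1, h.2.2⟩⟩

lemma enhancedGraph_adj (φ : Set Plane) (r : ℝ≥0∞) (ψ : Config) (x y : Plane) :
    (enhancedGraph (diskGraph φ r) ψ.points).Adj x y ↔
      (x ≠ y ∧ x ∈ φ ∧ y ∈ φ ∧ edist x y ≤ r) ∧ ((x, y), ψ) ∈ eitherSecure := by
  change ((diskGraph φ r).Adj x y ∧ _) ∨ ((diskGraph φ r).Adj y x ∧ _) ↔ (diskGraph φ r).Adj x y ∧ _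
  rw [(diskGraph φ r).adj_comm y x, ← and_or_left]
  exact Iff.rfl

section

variable {Ω : Type*} [MeasurableSpace Ω] {P : Measure Ω} {Φ Ψ : Ω → Set Plane} {lam : ℝ≥0}

lemma IsPoissonProcess.measure_securePairs (h : IsPoissonProcess Ψ lam P) (x y : Plane) :
    P {ω | ((x, y), h.config ω) ∈ securePairs} =
      ENNReal.ofReal (Real.exp (-(lam * (Real.pi * dist x y ^ 2)))) := by
  rw [← volume_closedBall_dist x dist_nonneg, ← h.measure_inter_eq_empty
    Metric.isClosed_closedBall.measurableSet measure_closedBall_lt_top.ne]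
  rfl

lemma IsPoissonProcess.measure_bothSecure (h : IsPoissonProcess Ψ lam P) (x y : Plane) :
    P {ω | ((x, y), h.config ω) ∈ bothSecure} =
      ENNReal.ofReal (Real.exp (-(lam * c * (Real.pi * dist x y ^ 2)))) := by
  rw [mul_assoc, ← volume_closedBall_union_closedBall, ← h.measure_inter_eq_empty
    (Metric.isClosed_closedBall.union Metric.isClosed_closedBall).measurableSet
    (Metric.isBounded_closedBall.union Metric.isBounded_closedBall).measure_lt_top.ne]
  congr 1
  ext ω
  rw [Set.mem_ofPred_eq, Set.mem_ofPred_eq, Set.inter_union_distrib_left, Set.union_empty_iff]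
  change _ ∧ Ψ ω ∩ Metric.closedBall y (dist y x) = ∅ ↔ _
  rw [dist_comm y x]
  rfl

/-- Inclusion-exclusion, in additive form to avoid truncated subtraction. -/
lemma IsPoissonProcess.measure_eitherSecure_add (h : IsPoissonProcess Ψ lam P) (x y : Plane) :
    P {ω | ((x, y), h.config ω) ∈ eitherSecure} + P {ω | ((x, y), h.config ω) ∈ bothSecure} =
      2 * ENNReal.ofReal (Real.exp (-(lam * (Real.pi * dist x y ^ 2)))) := by
  have hm : MeasurableSet {ω | ((y, x), h.config ω) ∈ securePairs} :=
    (measurable_const.prodMk h.measurable_config) measurableSet_securePairs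
  have := measure_union_add_inter (μ := P) {ω | ((x, y), h.config ω) ∈ securePairs} hm
  rw [h.measure_securePairs, h.measure_securePairs, dist_comm y x, ← two_mul] at this
  exact this

/-! ### Mean degrees and mean numbers of edges -/

/-- The mean degree of the origin, when points at distance `d` are adjacent with
probability `p d`. -/
lemma lintegral_degree [IsProbabilityMeasure P] (h : IsPoissonModel Φ Ψ lam P) (r : ℝ≥0∞)
    {D : Set ((Plane × Plane) × Config)} (hD : MeasurableSet D) {p : ℝ → ℝ≥0∞}
    (hp : ∀ x y, P {ω | ((x, y), h.eavesdroppers.config ω) ∈ D} = p (dist x y))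
    {G : Ω → SimpleGraph Plane}
    (hG : ∀ ω x y, (G ω).Adj x y ↔ (x ≠ y ∧ x ∈ insert 0 (Φ ω) ∧ y ∈ insert 0 (Φ ω) ∧
      edist x y ≤ r) ∧ ((x, y), h.eavesdroppers.config ω) ∈ D) :
    ∫⁻ ω, (degree (G ω) 0 : ℝ≥0∞) ∂P = ∫⁻ x : Plane in {x | edist 0 x ≤ r}, p ‖x‖ := by
  let S : Set (Plane × Config) := {q | 0 ≠ q.1} ∩ ({q | edist 0 q.1 ≤ r} ∩ {q | ((0, q.1), q.2) ∈ D})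
  have hD0 : MeasurableSet {q : Plane × Config | ((0, q.1), q.2) ∈ D} :=
    ((measurable_const.prodMk measurable_fst).prodMk measurable_snd) hD
  have hS : MeasurableSet S :=
    (measurable_fst (measurableSet_singleton (0 : Plane)).compl).congr (by ext q; exact ne_comm)
      |>.inter ((measurable_fst (measurableSet_edist_le r)).inter hD0)
  have h1 : ∀ ω, (degree (G ω) 0 : ℝ≥0∞) =
      pointKernel (h.nodes.config ω) {x | (x, h.eavesdroppers.config ω) ∈ S} := by
    intro ω
    have hm : MeasurableSet {x | (x, h.eavesdroppers.config ω) ∈ S} := measurable_prodMk_right hS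
    rw [pointKernel_apply_set _ hm, degree]
    congr 2
    ext y
    rw [SimpleGraph.mem_neighborSet, hG]
    constructor
    · rintro ⟨⟨h1, -, h2, h3⟩, h4⟩
      exact ⟨h2.resolve_left h1.symm, h1, h3, h4⟩
    · rintro ⟨h2, h1, h3, h4⟩
      exact ⟨⟨h1, Or.inl rfl, Or.inr h2, h3⟩, h4⟩
  rw [lintegral_congr h1, lintegral_kernel_of_indepFun h.nodes.measurable_config
    h.eavesdroppers.measurable_config h.indepFun_config pointKernel hS, h.nodes.bind_pointKernel,
    ENNReal.coe_one, one_smul, ← lintegral_indicator (measurableSet_edist_le r)]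
  -- The origin is excluded from `S` but lies in the disk of integration; it has area zero.
  have h0 : ∀ᵐ x : Plane, x ≠ 0 := by
    rw [ae_iff]
    simp
  refine lintegral_congr_ae ?_
  filter_upwards [h0] with x hx
  by_cases hxr : edist 0 x ≤ r
  · rw [Set.indicator_of_mem (show x ∈ {x : Plane | edist 0 x ≤ r} from hxr), ← dist_zero_left,
      ← hp]
    congr 1
    ext ω
    exact ⟨fun h => h.2.2, fun h => ⟨hx.symm, hxr, h⟩⟩
  · rw [Set.indicator_of_notMem (show x ∉ {x : Plane | edist 0 x ≤ r} from hxr)]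
    convert! measure_empty (μ := P)
    ext ω
    exact ⟨fun h => hxr h.2.1, fun h => h.elim⟩

lemma volume_prod_diagonal :
    ((volume : Measure Plane).prod (volume : Measure Plane)) (Set.diagonal Plane) = 0 := by
  rw [Measure.measure_prod_null measurableSet_diagonal]
  refine ae_of_all _ fun x => ?_
  have : Prod.mk x ⁻¹' Set.diagonal Plane = {x} := by
    ext y
    simp [eq_comm]
  simp [this]

lemma setLIntegral_compl_diagonal (f : Plane × Plane → ℝ≥0∞) :
    ∫⁻ q in (Set.diagonal Plane)ᶜ, f q ∂((volume : Measure Plane).prod volume) = ∫⁻ q, f q := by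
  rw [Measure.restrict_eq_self_of_ae_mem, Measure.volume_eq_prod]
  rw [ae_iff]
  simp only [Set.mem_compl_iff, not_not, Set.ofPred_mem_eq]
  exact volume_prod_diagonal

lemma midpoint_self_add (x z : Plane) : midpoint ℝ x (x + z) = x + (2⁻¹ : ℝ) • z := by
  rw [midpoint_eq_smul_add, invOf_eq_inv]
  module

lemma measurable_midpoint : Measurable fun q : Plane × Plane => midpoint ℝ q.1 q.2 := by
  simp only [midpoint_eq_smul_add]
  fun_prop

/-- Integration over pairs of points with midpoint in `B`. -/
lemma lintegral_midpoint_mem {f : Plane → ℝ≥0∞} (hf : Measurable f) {B : Set Plane}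
    (hB : MeasurableSet B) :
    ∫⁻ q : Plane × Plane, {q | midpoint ℝ q.1 q.2 ∈ B}.indicator (fun q => f (q.2 - q.1)) q =
      volume B * ∫⁻ z, f z := by
  have hF : Measurable fun q : Plane × Plane =>
      {q | midpoint ℝ q.1 q.2 ∈ B}.indicator (fun q => f (q.2 - q.1)) q :=
    Measurable.indicator (by fun_prop) (measurable_midpoint hB)
  have hF' : Measurable fun q : Plane × Plane =>
      B.indicator (fun _ => f q.2) (q.1 + (2⁻¹ : ℝ) • q.2) := by
    have : MeasurableSet {q : Plane × Plane | q.1 + (2⁻¹ : ℝ) • q.2 ∈ B} :=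
      (show Measurable fun q : Plane × Plane => q.1 + (2⁻¹ : ℝ) • q.2 by fun_prop) hB
    exact Measurable.indicator (f := fun q : Plane × Plane => f q.2) (by fun_prop) this
  rw [Measure.volume_eq_prod, lintegral_prod _ hF.aemeasurable]
  -- Substitute `y = x + z`, so that the midpoint is `x + z/2`. For fixed `z`, translation
  -- invariance in `x` then gives the factor `volume B`.
  calc _ = ∫⁻ x : Plane, ∫⁻ z : Plane, B.indicator (fun _ => f z) (x + (2⁻¹ : ℝ) • z) := by
        refine lintegral_congr fun x => ?_
        rw [← lintegral_add_left_eq_self _ x]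
        refine lintegral_congr fun z => ?_
        by_cases hz : x + (2⁻¹ : ℝ) • z ∈ B
        · rw [Set.indicator_of_mem hz, Set.indicator_of_mem (by
            rwa [Set.mem_ofPred_eq, midpoint_self_add]), add_sub_cancel_left]
        · rw [Set.indicator_of_notMem hz, Set.indicator_of_notMem (by
            rwa [Set.mem_ofPred_eq, midpoint_self_add])]
    _ = ∫⁻ z : Plane, ∫⁻ x : Plane, B.indicator (fun _ => f z) (x + (2⁻¹ : ℝ) • z) :=
        lintegral_lintegral_swap hF'.aemeasurable
    _ = ∫⁻ z : Plane, volume B * f z := by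
        refine lintegral_congr fun z => ?_
        rw [lintegral_add_right_eq_self (B.indicator fun _ => f z), lintegral_indicator_const hB,
          mul_comm]
    _ = _ := lintegral_const_mul _ hf

/-- Twice the mean number of edges located in `B`, when points at distance `d` are adjacent with
probability `p d`. -/
lemma two_mul_lintegral_edgeCount [IsProbabilityMeasure P] (h : IsPoissonModel Φ Ψ lam P) (r : ℝ≥0∞)
    {D : Set ((Plane × Plane) × Config)} (hD : MeasurableSet D) {p : ℝ → ℝ≥0∞}
    (hpm : Measurable p)
    (hp : ∀ x y, P {ω | ((x, y), h.eavesdroppers.config ω) ∈ D} = p (dist x y))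
    {G : Ω → SimpleGraph Plane}
    (hG : ∀ ω x y, (G ω).Adj x y ↔ (x ≠ y ∧ x ∈ Φ ω ∧ y ∈ Φ ω ∧ edist x y ≤ r) ∧
      ((x, y), h.eavesdroppers.config ω) ∈ D) {B : Set Plane} (hB : MeasurableSet B) :
    2 * ∫⁻ ω, (edgeCount (G ω) B : ℝ≥0∞) ∂P =
      volume B * ∫⁻ x : Plane in {x | edist 0 x ≤ r}, p ‖x‖ := by
  let T : Set (Plane × Plane) := {q | midpoint ℝ q.1 q.2 ∈ B} ∩ {q | edist q.1 q.2 ≤ r}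
  have hT : MeasurableSet T :=
    (measurable_midpoint hB).inter (measurableSet_le (by fun_prop) measurable_const)
  let S : Set ((Plane × Plane) × Config) := Prod.fst ⁻¹' ((Set.diagonal Plane)ᶜ ∩ T) ∩ D
  have hS : MeasurableSet S := (measurable_fst (measurableSet_diagonal.compl.inter hT)).inter hD
  have h1 : ∀ ω, 2 * (edgeCount (G ω) B : ℝ≥0∞) =
      pairKernel (h.nodes.config ω) {q | (q, h.eavesdroppers.config ω) ∈ S} := by
    intro ω
    have hm : MeasurableSet {q | (q, h.eavesdroppers.config ω) ∈ S} := measurable_prodMk_right hS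
    rw [pairKernel_apply_set _ hm, ← ENat.toENNReal_ofNat,
      ← ENat.toENNReal_mul, two_mul_edgeCount]
    congr 2
    ext ⟨x, y⟩
    rw [Set.mem_ofPred_eq, hG]
    constructor
    · rintro ⟨⟨⟨h1, h2, h3, h4⟩, h5⟩, h6⟩
      exact ⟨⟨h2, h3⟩, ⟨h1, h6, h4⟩, h5⟩
    · rintro ⟨⟨h2, h3⟩, ⟨h1, h6, h4⟩, h5⟩
      exact ⟨⟨⟨h1, h2, h3, h4⟩, h5⟩, h6⟩
  have h2 : ∀ q : Plane × Plane, P {ω | (q, h.eavesdroppers.config ω) ∈ S} =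
      (Set.diagonal Plane)ᶜ.indicator (T.indicator fun q => p (dist q.1 q.2)) q := by
    intro q
    rw [Set.indicator_indicator]
    by_cases hq : q ∈ (Set.diagonal Plane)ᶜ ∩ T
    · rw [Set.indicator_of_mem hq, ← hp]
      congr 1
      ext ω
      exact ⟨fun h => h.2, fun h => ⟨hq, h⟩⟩
    · rw [Set.indicator_of_notMem hq]
      convert! measure_empty (μ := P)
      ext ω
      exact ⟨fun h => hq h.1, fun h => h.elim⟩
  have h3 : ∀ q : Plane × Plane, T.indicator (fun q => p (dist q.1 q.2)) q =
      {q | midpoint ℝ q.1 q.2 ∈ B}.indicator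
        (fun q => {x : Plane | edist 0 x ≤ r}.indicator (fun x => p ‖x‖) (q.2 - q.1)) q := by
    intro q
    have he : edist 0 (q.2 - q.1) = edist q.1 q.2 := by
      rw [edist_dist, edist_dist, dist_zero_left, dist_comm, dist_eq_norm]
    have hn : ‖q.2 - q.1‖ = dist q.1 q.2 := by rw [dist_comm, dist_eq_norm]
    rw [← Set.indicator_indicator]
    simp only [Set.indicator, Set.mem_ofPred_eq, he, hn]
  -- Edges join distinct points, so only the off-diagonal part of the second moment measure enters.
  -- There it is Lebesgue × Lebesgue, for which the diagonal is null and can be restored.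
  rw [← lintegral_const_mul' _ _ ENNReal.ofNat_ne_top, lintegral_congr h1,
    lintegral_kernel_of_indepFun h.nodes.measurable_config
    h.eavesdroppers.measurable_config h.indepFun_config pairKernel hS, lintegral_congr h2,
    lintegral_indicator measurableSet_diagonal.compl, h.nodes.restrict_bind_pairKernel,
    ENNReal.coe_one, one_smul, setLIntegral_compl_diagonal, lintegral_congr h3,
    lintegral_midpoint_mem ((by fun_prop : Measurable fun x : Plane => p ‖x‖).indicator
      (measurableSet_edist_le r)) hB, lintegral_indicator (measurableSet_edist_le r)]

end

/-- The probability that a pair at distance `d` is secure in at least one direction. -/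
noncomputable def eitherProb (lam d : ℝ) : ℝ≥0∞ :=
  2 * ENNReal.ofReal (Real.exp (-(lam * (Real.pi * d ^ 2)))) -
    ENNReal.ofReal (Real.exp (-(lam * c * (Real.pi * d ^ 2))))

lemma measurable_eitherProb (lam : ℝ) : Measurable (eitherProb lam) := by
  unfold eitherProb
  fun_prop

lemma IsPoissonProcess.measure_eitherSecure {Ω : Type*} [MeasurableSpace Ω] {P : Measure Ω}
    {Ψ : Ω → Set Plane} {lam : ℝ≥0} (h : IsPoissonProcess Ψ lam P) (x y : Plane) :
    P {ω | ((x, y), h.config ω) ∈ eitherSecure} = eitherProb lam (dist x y) := by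
  rw [eitherProb, ← h.measure_eitherSecure_add, ← h.measure_bothSecure,
    ENNReal.add_sub_cancel_right]
  rw [h.measure_bothSecure]
  exact ENNReal.ofReal_ne_top

/-- The subtraction in `eitherProb` is not truncated, because `c ≥ 1` makes the subtracted term the
smaller one. -/
lemma eitherProb_add (lam : ℝ≥0) (d : ℝ) :
    eitherProb lam d + ENNReal.ofReal (Real.exp (-(lam * c * (Real.pi * d ^ 2)))) =
      2 * ENNReal.ofReal (Real.exp (-(lam * (Real.pi * d ^ 2)))) := by
  rw [eitherProb, tsub_add_cancel_of_le]
  have h1 : ENNReal.ofReal (Real.exp (-(lam * c * (Real.pi * d ^ 2)))) ≤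
      ENNReal.ofReal (Real.exp (-(lam * (Real.pi * d ^ 2)))) := by
    refine ENNReal.ofReal_le_ofReal (Real.exp_le_exp.2 (neg_le_neg ?_))
    refine mul_le_mul_of_nonneg_right ?_ (by positivity)
    exact le_mul_of_one_le_right lam.2 one_lt_c.le
  exact h1.trans (le_mul_of_one_le_left' one_le_two)

/-- The integral of the adjacency probability of the enhanced secrecy graph. -/
noncomputable def eitherDisk (lam : ℝ) (r : ℝ≥0∞) : ℝ≥0∞ :=
  ∫⁻ x : Plane in {x | edist 0 x ≤ r}, eitherProb lam ‖x‖

lemma eitherDisk_add (lam : ℝ≥0) (r : ℝ≥0∞) :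
    eitherDisk lam r + gaussDisk (lam * c) r = 2 * gaussDisk lam r := by
  rw [eitherDisk, gaussDisk, gaussDisk, ← lintegral_add_right _ (by fun_prop),
    ← lintegral_const_mul _ (by fun_prop)]
  exact lintegral_congr fun x => eitherProb_add lam ‖x‖

section

variable {Ω : Type*} [MeasurableSpace Ω] {P : Measure Ω} [IsProbabilityMeasure P]
  {Φ Ψ : Ω → Set Plane} {lam : ℝ≥0}

lemma meanDegreeBasic_eq (h : IsPoissonModel Φ Ψ lam P) (r : ℝ≥0∞) :
    meanDegreeBasic Φ Ψ r P = gaussDisk (lam * c) r :=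
  lintegral_degree h r measurableSet_bothSecure
    (p := fun d => ENNReal.ofReal (Real.exp (-(lam * c * (Real.pi * d ^ 2)))))
    h.eavesdroppers.measure_bothSecure
    fun ω => basicGraph_adj _ r (h.eavesdroppers.config ω)

lemma meanDegreeEnhanced_eq (h : IsPoissonModel Φ Ψ lam P) (r : ℝ≥0∞) :
    meanDegreeEnhanced Φ Ψ r P = eitherDisk lam r :=
  lintegral_degree h r measurableSet_eitherSecure h.eavesdroppers.measure_eitherSecure
    fun ω => enhancedGraph_adj _ r (h.eavesdroppers.config ω)

lemma two_mul_meanEdgesBasic (h : IsPoissonModel Φ Ψ lam P) (r : ℝ≥0∞) {B : Set Plane}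
    (hB : MeasurableSet B) :
    2 * meanEdgesBasic Φ Ψ r P B = volume B * gaussDisk (lam * c) r :=
  two_mul_lintegral_edgeCount h r measurableSet_bothSecure
    (p := fun d => ENNReal.ofReal (Real.exp (-(lam * c * (Real.pi * d ^ 2))))) (by fun_prop)
    h.eavesdroppers.measure_bothSecure
    (fun ω => basicGraph_adj _ r (h.eavesdroppers.config ω)) hB

lemma two_mul_meanEdgesEnhanced (h : IsPoissonModel Φ Ψ lam P) (r : ℝ≥0∞) {B : Set Plane}
    (hB : MeasurableSet B) :
    2 * meanEdgesEnhanced Φ Ψ r P B = volume B * eitherDisk lam r :=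
  two_mul_lintegral_edgeCount h r measurableSet_eitherSecure (measurable_eitherProb lam)
    h.eavesdroppers.measure_eitherSecure
    (fun ω => enhancedGraph_adj _ r (h.eavesdroppers.config ω)) hB

end

lemma inv_two_mul_c_sub_one :
    (2 * c - 1)⁻¹ = 3 * Real.pi / (5 * Real.pi + 3 * √3) := by
  have h : 2 * c - 1 = (5 * Real.pi + 3 * √3) / (3 * Real.pi) := by
    rw [c]
    field_simp
    ring
  rw [h, inv_div]

lemma abs_ratio_sub_lt : |3 * Real.pi / (5 * Real.pi + 3 * √3) - 0.45| < 0.005 := by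
  have h1 := Real.pi_gt_d2
  have h2 := Real.pi_lt_d2
  have h3 : (1.732 : ℝ) < √3 := Real.lt_sqrt_of_sq_lt (by norm_num)
  have h4 : √3 < 1.733 := (Real.sqrt_lt' (by norm_num)).2 (by norm_num)
  have hpos : 0 < 5 * Real.pi + 3 * √3 := by positivity
  rw [abs_lt, lt_sub_iff_add_lt, sub_lt_iff_lt_add, lt_div_iff₀ hpos, div_lt_iff₀ hpos]
  constructor <;> linarith

end SecrecyGraph

theorem mainTheorem5 :
    -- the fraction of edges of the enhanced graph that lie in the basic graph
    (∀ {Ω : Type*} [MeasurableSpace Ω] (P : Measure Ω) [IsProbabilityMeasure P]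
        (Φ Ψ : Ω → Set SecrecyGraph.Plane) (lam : ℝ≥0) (r : ℝ≥0∞),
        SecrecyGraph.IsPoissonModel Φ Ψ lam P → r ≠ 0 → (lam ≠ 0 ∨ r ≠ ∞) →
        ∀ B : Set SecrecyGraph.Plane, MeasurableSet B → volume B ≠ 0 → volume B ≠ ∞ →
          SecrecyGraph.meanEdgesEnhanced Φ Ψ r P B ≠ 0 ∧
          SecrecyGraph.meanEdgesEnhanced Φ Ψ r P B ≠ ∞ ∧
          ENNReal.ofReal (3 * Real.pi / (5 * Real.pi + 3 * √3)) ≤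
            SecrecyGraph.meanEdgesBasic Φ Ψ r P B / SecrecyGraph.meanEdgesEnhanced Φ Ψ r P B) ∧
    |3 * Real.pi / (5 * Real.pi + 3 * √3) - 0.45| < 0.005 ∧
    -- the ratio of the mean degrees, as a function of `lam * r ^ 2` in `[0, ∞]`
    ∃ ρ : ℝ≥0∞ → ℝ,
      (∀ {Ω : Type*} [MeasurableSpace Ω] (P : Measure Ω) [IsProbabilityMeasure P]
        (Φ Ψ : Ω → Set SecrecyGraph.Plane) (lam : ℝ≥0) (r : ℝ≥0∞),
        SecrecyGraph.IsPoissonModel Φ Ψ lam P → r ≠ 0 → (lam ≠ 0 ∨ r ≠ ∞) →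
          SecrecyGraph.meanDegreeEnhanced Φ Ψ r P ≠ 0 ∧
          SecrecyGraph.meanDegreeEnhanced Φ Ψ r P ≠ ∞ ∧
          SecrecyGraph.meanDegreeBasic Φ Ψ r P / SecrecyGraph.meanDegreeEnhanced Φ Ψ r P =
            ENNReal.ofReal (ρ (lam * r ^ 2))) ∧
      StrictAnti ρ ∧
      ρ 0 = 1 ∧ Tendsto ρ (𝓝 0) (𝓝 1) ∧
      ρ ∞ = (2 * SecrecyGraph.c - 1)⁻¹ ∧ Tendsto ρ (𝓝 ∞) (𝓝 (2 * SecrecyGraph.c - 1)⁻¹) := by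
  refine ⟨?_, SecrecyGraph.abs_ratio_sub_lt, SecrecyGraph.degreeRatio, ?_,
    SecrecyGraph.degreeRatio_strictAnti, SecrecyGraph.degreeRatio_zero,
    SecrecyGraph.tendsto_degreeRatio_zero, SecrecyGraph.degreeRatio_top,
    SecrecyGraph.tendsto_degreeRatio_top⟩
  · intro Ω _ P _ Φ Ψ lam r h hr hlr B hB hB0 hBt
    obtain ⟨h0, ht, hdiv⟩ :=
      SecrecyGraph.gaussDisk_div hr hlr (SecrecyGraph.eitherDisk_add lam r)
    have hb := SecrecyGraph.two_mul_meanEdgesBasic h r hB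
    have he := SecrecyGraph.two_mul_meanEdgesEnhanced h r hB
    refine ⟨fun h' => ?_, fun h' => ?_, ?_⟩
    · rw [h', mul_zero] at he
      exact mul_ne_zero hB0 h0 he.symm
    · rw [h', ENNReal.mul_top two_ne_zero] at he
      exact ENNReal.mul_ne_top hBt ht he.symm
    -- The factors `2` and `volume B` cancel, so the ratio of edge densities equals the ratio of
    -- mean degrees, which is at least its value at `∞`.
    · rw [← ENNReal.mul_div_mul_left _ _ two_ne_zero ENNReal.ofNat_ne_top, hb, he,
        ENNReal.mul_div_mul_left _ _ hB0 hBt, hdiv, ← SecrecyGraph.inv_two_mul_c_sub_one,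
        ← SecrecyGraph.degreeRatio_top]
      exact ENNReal.ofReal_le_ofReal (SecrecyGraph.degreeRatio_strictAnti.antitone le_top)
  · intro Ω _ P _ Φ Ψ lam r h hr hlr
    rw [SecrecyGraph.meanDegreeBasic_eq h, SecrecyGraph.meanDegreeEnhanced_eq h]
    exact SecrecyGraph.gaussDisk_div hr hlr (SecrecyGraph.eitherDisk_add lam r)
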